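/- **Setting.** Let $d,\kappa\ge 0$ and $J\ge 1$ be integers, $\overline\Omega\subseteq\mathbb R^d$ open, $\Omega\subseteq\overline\Omega$ compact, $f_1,\dots,f_\kappa:\overline\Omega\to\mathbb R$ real-analytic, and $\mathbf A_1,\dots,\mathbf A_\kappa$ compact self-adjoint operators on the complex space $\ell^2(\mathbb N)$. Put $\mathbf A(\omega)=\sum_{i=1}^{\kappa} f_i(\omega)\mathbf A_i$ and let $\lambda_j(\omega)$ be the $j$th largest eigenvalue of $\mathbf A(\omega)$, counted with multiplicity. Assume that $\mathbf A(\omega)$ has at least $J$ positive eigenvalues (with multiplicity) for every $\omega\in\Omega$. For a finite-dimensional subspace $\mathcal V\subseteq\ell^2(\mathbb N)$ with orthonormal basis $v_1,\dots,v_m$, let $\mathbf V:\mathbb C^m\to\ell^2(\mathbb N)$, $\mathbf V\alpha=\sum_j\alpha_jv_j$, and let $\lambda_j^{\mathcal V}(\omega)$ be the $j$th largest eigenvalue of $\mathbf V^*\mathbf A(\omega)\mathbf V$. *Eigenvectors corresponding to* $\lambda_1(\omega),\dots,\lambda_J(\omega)$ means linearly independent $s_1,\dots,s_J$ with $\mathbf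 A(\omega)s_j=\lambda_j(\omega)s_j$. An eigenvalue is *simple* if its eigenspace has dimension $1$. **Algorithm 1.** Choose $\omega^{(1)}\in\Omega$ and let $\mathcal S_1$ be the span of eigenvectors corresponding to $\lambda_1(\omega^{(1)}),\dots,\lambda_J(\omega^{(1)})$. For $k=2,3,\dots$, with $\lambda_j^{(k-1)}:=\lambda_j^{\mathcal S_{k-1}}$, let $\omega^{(k)}$ be any global minimizer over $\Omega$ (throughout the run: minimization problem) or any global maximizer over $\Omega$ (throughout the run: maximization problem) of $\lambda_J^{(k-1)}$, and let $\mathcal S_k$ be the sum of $\mathcal S_{k-1}$ and the span of eigenvectors corresponding to $\lambda_1(\omega^{(k)}),\dots,\lambda_J(\omega^{(k)})$. **Algorithm 2.** As Algorithm 1, but for $k\ge2$ put $h^{(k)}=\|\omega^{(k)}-\omega^{(k-1)}\|_2$, and add to $\mathcal S_k$ also, for all $1\le p\le q\le d$, the span of eigenvectors corresponding to $\lambda_1,\dots,\lambda_J$ at $\omega^{(k)}+h^{(k)}e_{pq}$, where $e_{pp}=e_p$ and $e_{pq}=(e_p+e_q)/\sqrt2$ for $p\ne q$. It is understood that every extra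 point $\omega^{(k)}+h^{(k)}e_{pq}$ that is used lies in $\overline\Omega$ and that $\mathbf A$ has at least $J$ positive eigenvalues there. **Lemma (Hermite interpolation).** Consider the first $K$ steps of a run of Algorithm 1, for any $K$, and let $1\le\ell\le k\le K$. The following hold at $x=\omega^{(\ell)}$: 1. $\lambda_J(x)=\lambda_J^{(k)}(x)$; 2. if $J>1$, then $\lambda_{J-1}(x)=\lambda_{J-1}^{(k)}(x)$; 3. if $\lambda_J(x)$ is a simple eigenvalue of $\mathbf A(x)$, then $\lambda_J^{(k)}(x)$ is a simple eigenvalue of the reduced operator at $x$ for $\mathcal V=\mathcal S_k$; 4. if $\lambda_J(x)$ is simple, then $\lambda_J$ and $\lambda_J^{(k)}$ are differentiable at $x$ and $\nabla\lambda_J(x)=\nabla\lambda_J^{(k)}(x)$. For the first $K$ steps of a run of Algorithm 2, statements 1–4 hold at $x=\omega^{(\ell)}$ for all $1\le\ell\le k\le K$, and also at every extra point $x=\omega^{(\ell)}+h^{(\ell)}e_{pq}$ with $2\le\ell\le k\le K$ and $1\le p\le q\le d$. -/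

import Mathlib

noncomputable section

namespace EigOpt

/-- The sequence space `ℓ²(ℕ)` of square summable complex sequences. -/
abbrev Ell2 : Type := lp (fun _ : ℕ => ℂ) 2

/-- The parameter space `ℝᵈ` with the Euclidean norm. -/
abbrev Param (d : ℕ) : Type := EuclideanSpace ℝ (Fin d)

section Eigenvalues

variable {E : Type} [NormedAddCommGroup E] [InnerProductSpace ℂ E]

/-- The eigenspace `ker (μ I - T)` of `T` for the real number `μ`. -/
def eigSpace (T : E →L[ℂ] E) (μ : ℝ) : Submodule ℂ E :=
  Module.End.eigenspace (T : E →ₗ[ℂ] E) (μ : ℂ)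

/-- The number of eigenvalues of `T` in the set `I`, counted with multiplicity: the dimension of
the span of the corresponding eigenspaces. It is a cardinal, so that it is meaningful also when
it is infinite. -/
def eigCount (T : E →L[ℂ] E) (I : Set ℝ) : Cardinal :=
  Module.rank ℂ (⨆ μ ∈ I, eigSpace T μ : Submodule ℂ E)

/-- The `j`th largest eigenvalue of `T` (for `j ≥ 1`, counted with multiplicity): the largest
number `x` such that at least `j` eigenvalues of `T` are `≥ x`. For a compact self-adjoint
operator with at least `j` positive eigenvalues, and for a Hermitian operator on a space of finite
dimension `≥ j`, the supremum is attained, at an eigenvalue. -/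
def eigLargest (T : E →L[ℂ] E) (j : ℕ) : ℝ :=
  sSup {x : ℝ | (j : Cardinal) ≤ eigCount T (Set.Ici x)}

/-- `T` has at least `j` positive eigenvalues, counted with multiplicity. -/
def HasPosEigs (T : E →L[ℂ] E) (j : ℕ) : Prop :=
  (j : Cardinal) ≤ eigCount T (Set.Ioi 0)

/-- The real number `μ` is a simple eigenvalue of `T`. -/
def IsSimpleEig (T : E →L[ℂ] E) (μ : ℝ) : Prop :=
  Module.finrank ℂ (eigSpace T μ) = 1

/-- `s₁, …, s_J` are (linearly independent) eigenvectors corresponding to the `J` largest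
eigenvalues `λ₁ ≥ ⋯ ≥ λ_J` of `T`; the vector `s i` belongs to the eigenvalue number `i + 1`, as
`Fin J` starts at `0`. -/
def IsLeadingEigenvectors (T : E →L[ℂ] E) {J : ℕ} (s : Fin J → E) : Prop :=
  LinearIndependent ℂ s ∧
    ∀ i : Fin J, Module.End.HasEigenvector (T : E →ₗ[ℂ] E)
      ((eigLargest T ((i : ℕ) + 1) : ℝ) : ℂ) (s i)

end Eigenvalues

/-- The operator `A(ω) = ∑ f_ℓ(ω) A_ℓ`. -/
def opFun {d κ : ℕ} (f : Fin κ → Param d → ℝ) (A : Fin κ → Ell2 →L[ℂ] Ell2) (ω : Param d) :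
    Ell2 →L[ℂ] Ell2 :=
  ∑ i, ((f i ω : ℝ) : ℂ) • A i

/-- The map `𝐕 : ℂᵐ → ℓ²(ℕ)`, `𝐕 α = ∑ α_j v_j`, for an orthonormal basis `v₁, …, v_m` of the
subspace `𝒱`. -/
def basisMap {𝒱 : Submodule ℂ Ell2} {m : ℕ} (v : OrthonormalBasis (Fin m) ℂ 𝒱) :
    EuclideanSpace ℂ (Fin m) →L[ℂ] Ell2 :=
  𝒱.subtypeL ∘L (v.repr.symm.toContinuousLinearEquiv : EuclideanSpace ℂ (Fin m) →L[ℂ] 𝒱)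

/-- The reduced operator `𝐕* T 𝐕` on `ℂᵐ`. -/
def reducedOp {𝒱 : Submodule ℂ Ell2} {m : ℕ} (v : OrthonormalBasis (Fin m) ℂ 𝒱)
    (T : Ell2 →L[ℂ] Ell2) : EuclideanSpace ℂ (Fin m) →L[ℂ] EuclideanSpace ℂ (Fin m) :=
  ContinuousLinearMap.adjoint (basisMap v) ∘L T ∘L basisMap v

/-- The `j`th largest eigenvalue `λ_j(ω)` of `A(ω)`. -/
def lam {d : ℕ} (A : Param d → Ell2 →L[ℂ] Ell2) (j : ℕ) (ω : Param d) : ℝ :=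
  eigLargest (A ω) j

/-- The `j`th largest eigenvalue `λ_j^𝒱(ω)` of the reduced operator `𝐕* A(ω) 𝐕`. -/
def lamRed {d : ℕ} (A : Param d → Ell2 →L[ℂ] Ell2) {𝒱 : Submodule ℂ Ell2} {m : ℕ}
    (v : OrthonormalBasis (Fin m) ℂ 𝒱) (j : ℕ) (ω : Param d) : ℝ :=
  eigLargest (reducedOp v (A ω)) j

/-- The two problems: minimization and maximization of the eigenvalue function. -/
inductive Goal : Type
  | minimize
  | maximize

/-- `x` is a global minimizer, respectively maximizer, of `g` over `Ω`. -/
def Goal.IsOptimizer {d : ℕ} (goal : Goal) (g : Param d → ℝ) (Ω : Set (Param d))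
    (x : Param d) : Prop :=
  match goal with
  | .minimize => x ∈ Ω ∧ IsMinOn g Ω x
  | .maximize => x ∈ Ω ∧ IsMaxOn g Ω x

/-- The first `K` steps of a run of the greedy subspace procedure, for the operator function `A`
on the feasible set `Ω` and the `J`th largest eigenvalue. Steps are numbered `1, …, K`; entries
with other indices carry no meaning. An infinite run gives such an object for every `K`. -/
structure GreedyRun {d : ℕ} (goal : Goal) (A : Param d → Ell2 →L[ℂ] Ell2)
    (Ω : Set (Param d)) (J K : ℕ) where
  /-- the iterates `ω⁽ᵏ⁾` -/
  ω : ℕ → Param d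
  /-- the eigenvectors `s⁽ᵏ⁾₁, …, s⁽ᵏ⁾_J` -/
  s : ℕ → Fin J → Ell2
  /-- the subspaces `𝒮_k` -/
  S : ℕ → Submodule ℂ Ell2
  /-- the dimension of `𝒮_k` -/
  m : ℕ → ℕ
  /-- an orthonormal basis of `𝒮_k`, in which the reduced operator is represented -/
  basis : ∀ k, OrthonormalBasis (Fin (m k)) ℂ (S k)
  start_mem : ω 1 ∈ Ω
  eigvec : ∀ k, 1 ≤ k → k ≤ K → IsLeadingEigenvectors (A (ω k)) (s k)
  space_one : S 1 = Submodule.span ℂ (Set.range (s 1))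
  optimal : ∀ k, 1 ≤ k → k + 1 ≤ K →
    goal.IsOptimizer (lamRed A (basis k) J) Ω (ω (k + 1))
  space_succ : ∀ k, 1 ≤ k → k + 1 ≤ K →
    S (k + 1) = S k ⊔ Submodule.span ℂ (Set.range (s (k + 1)))

/-- The directions `e_{pp} = e_p` and `e_{pq} = (e_p + e_q) / √2` for `p ≠ q`. -/
def dir {d : ℕ} (p q : Fin d) : Param d :=
  if p = q then EuclideanSpace.single p 1
  else (1 / Real.sqrt 2) • (EuclideanSpace.single p 1 + EuclideanSpace.single q 1)

/-- The first `K` steps of a run of the extended greedy subspace procedure. Steps are numbered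
`1, …, K`; the step lengths `h⁽ᵏ⁾` and the extra eigenvectors exist from step `2` on and for
`p ≤ q`. Entries with other indices carry no meaning. -/
structure ExtendedGreedyRun {d : ℕ} (goal : Goal) (A : Param d → Ell2 →L[ℂ] Ell2)
    (Ω : Set (Param d)) (J K : ℕ) where
  /-- the iterates `ω⁽ᵏ⁾` -/
  ω : ℕ → Param d
  /-- the eigenvectors `s⁽ᵏ⁾₁, …, s⁽ᵏ⁾_J` -/
  s : ℕ → Fin J → Ell2
  /-- the step lengths `h⁽ᵏ⁾` -/
  h : ℕ → ℝ
  /-- the eigenvectors `s⁽ᵏ⁾_{1,pq}, …, s⁽ᵏ⁾_{J,pq}` -/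
  t : ℕ → Fin d → Fin d → Fin J → Ell2
  /-- the subspaces `𝒮_k` -/
  S : ℕ → Submodule ℂ Ell2
  /-- the dimension of `𝒮_k` -/
  m : ℕ → ℕ
  /-- an orthonormal basis of `𝒮_k`, in which the reduced operator is represented -/
  basis : ∀ k, OrthonormalBasis (Fin (m k)) ℂ (S k)
  start_mem : ω 1 ∈ Ω
  eigvec : ∀ k, 1 ≤ k → k ≤ K → IsLeadingEigenvectors (A (ω k)) (s k)
  space_one : S 1 = Submodule.span ℂ (Set.range (s 1))
  optimal : ∀ k, 1 ≤ k → k + 1 ≤ K →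
    goal.IsOptimizer (lamRed A (basis k) J) Ω (ω (k + 1))
  step : ∀ k, 1 ≤ k → k + 1 ≤ K → h (k + 1) = ‖ω (k + 1) - ω k‖
  eigvec_extra : ∀ k, 1 ≤ k → k + 1 ≤ K → ∀ p q : Fin d, p ≤ q →
    IsLeadingEigenvectors (A (ω (k + 1) + h (k + 1) • dir p q)) (t (k + 1) p q)
  space_succ : ∀ k, 1 ≤ k → k + 1 ≤ K →
    S (k + 1) = S k ⊔ Submodule.span ℂ (Set.range (s (k + 1))) ⊔
      ⨆ (p : Fin d) (q : Fin d) (_ : p ≤ q), Submodule.span ℂ (Set.range (t (k + 1) p q))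

/-- The extra points `ω⁽ᵏ⁾ + h⁽ᵏ⁾ e_{pq}`. -/
def ExtendedGreedyRun.extraPoint {d : ℕ} {goal : Goal} {A : Param d → Ell2 →L[ℂ] Ell2}
    {Ω : Set (Param d)} {J K : ℕ} (R : ExtendedGreedyRun goal A Ω J K)
    (k : ℕ) (p q : Fin d) : Param d :=
  R.ω k + R.h k • dir p q

/-- Hermite interpolation of `λ_J` by `λ_J^𝒱` at the point `x`. -/
structure HermiteInterpolatesAt {d : ℕ} (A : Param d → Ell2 →L[ℂ] Ell2)
    {𝒱 : Submodule ℂ Ell2} {m : ℕ} (v : OrthonormalBasis (Fin m) ℂ 𝒱) (J : ℕ)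
    (x : Param d) : Prop where
  value : lam A J x = lamRed A v J x
  value_pred : 1 < J → lam A (J - 1) x = lamRed A v (J - 1) x
  simple : IsSimpleEig (A x) (lam A J x) →
    IsSimpleEig (reducedOp v (A x)) (lamRed A v J x)
  grad : IsSimpleEig (A x) (lam A J x) →
    DifferentiableAt ℝ (lam A J) x ∧ DifferentiableAt ℝ (lamRed A v J) x ∧
      gradient (lam A J) x = gradient (lamRed A v J) x

end EigOpt

end

/-!
The proof rests on the Courant-Fischer principle in counting form (`le_eigCount_Ici_iff`): a compact
self-adjoint operator has at least `j` eigenvalues `≥ c` exactly when its quadratic form is at least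
`c` on some subspace of dimension `j`. One direction is a computation with orthogonal eigenspaces;
the other holds because, by the spectral theorem, the quadratic form is strictly below `c` on the
orthogonal complement of the eigenspaces for the eigenvalues `≥ c`.

*Values.* The reduced operator is a compression `V* T V` by an isometry `V`, so by Courant-Fischer
it has at most as many eigenvalues above any bound as `T`. If the subspace contains the leading
eigenvectors of `T`, these are eigenvectors of the compression as well, and equality follows
(`eigLargest_compression`). This applies to the eigenvalues number `J` and `J - 1`.

*Simplicity and gradients.* If `λ_J` is a simple eigenvalue of `T`, then the leading eigenvectors
span all eigenspaces for eigenvalues `≥ λ_J`, and `λ_J` is isolated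
(`IsLeadingEigenvectors.exists_spectralGap`); positivity enters here, through the finiteness of the
part of the spectrum of a compact operator that is bounded away from zero. The resulting structure
`SpectralGap` is expressed through the quadratic form and finitely many eigenvectors, and therefore
passes to the compression (`SpectralGap.compression`). It implies simplicity, and the two-sided
min-max estimate

  `|λ_J(T') - (λ_J(T) + ⟨(T' - T) u, u⟩)| ≤ C ‖T' - T‖²`

for the unit eigenvector `u` of `T` and all nearby compact self-adjoint `T'`
(`SpectralGap.abs_eigLargest_sub_le`). Consequently `λ_J` is differentiable, with the derivative of
`ω ↦ ⟨A(ω) u, u⟩`. The first order term `⟨(T' - T) u, u⟩` is the same for the operator and for its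
compression, hence so are the gradients.
-/

noncomputable section

namespace EigOpt

/-! ### Eigenspaces and the Courant-Fischer principle -/

section Eigenvalues

variable {E : Type} [NormedAddCommGroup E] [InnerProductSpace ℂ E]

/-- The span of the eigenspaces of `T` for the real eigenvalues in `I`. -/
def specSpace (T : E →L[ℂ] E) (I : Set ℝ) : Submodule ℂ E :=
  ⨆ μ ∈ I, eigSpace T μ

theorem mem_eigSpace {T : E →L[ℂ] E} {μ : ℝ} {v : E} :
    v ∈ eigSpace T μ ↔ T v = (μ : ℂ) • v :=
  Module.End.mem_eigenspace_iff

theorem eigSpace_le_specSpace (T : E →L[ℂ] E) {I : Set ℝ} {μ : ℝ} (hμ : μ ∈ I) :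
    eigSpace T μ ≤ specSpace T I :=
  le_iSup₂_of_le μ hμ le_rfl

theorem specSpace_mono (T : E →L[ℂ] E) {I I' : Set ℝ} (h : I ⊆ I') :
    specSpace T I ≤ specSpace T I' :=
  biSup_mono h

theorem eigCount_eq (T : E →L[ℂ] E) (I : Set ℝ) :
    eigCount T I = Module.rank ℂ (specSpace T I) := rfl

theorem re_inner_eigenvector {T : E →L[ℂ] E} {μ : ℝ} {v : E} (hv : v ∈ eigSpace T μ) :
    (inner ℂ (T v) v).re = μ * ‖v‖ ^ 2 := by
  rw [mem_eigSpace.1 hv, inner_smul_left, inner_self_eq_norm_sq_to_K]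
  simp only [Complex.conj_ofReal, Complex.coe_algebraMap, ← Complex.ofReal_pow]
  rw [← Complex.ofReal_mul, Complex.ofReal_re]

theorem inner_eq_zero_of_mem_eigSpace {T : E →L[ℂ] E} (hT : (T : E →ₗ[ℂ] E).IsSymmetric) {μ ν : ℝ}
    (hμν : μ ≠ ν) {v w : E} (hv : v ∈ eigSpace T μ) (hw : w ∈ eigSpace T ν) :
    inner ℂ v w = 0 :=
  hT.orthogonalFamily_eigenspaces (i := (μ : ℂ)) (j := (ν : ℂ))
    (by simpa using hμν) ⟨v, hv⟩ ⟨w, hw⟩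

/-- On the span of the eigenspaces for eigenvalues `≥ c`, the quadratic form of `T` is at
least `c`. -/
theorem le_re_inner_of_mem_specSpace {T : E →L[ℂ] E} (hT : (T : E →ₗ[ℂ] E).IsSymmetric) {c : ℝ} {v : E}
    (hv : v ∈ specSpace T (Set.Ici c)) : c * ‖v‖ ^ 2 ≤ (inner ℂ (T v) v).re := by
  rw [specSpace, iSup_subtype', Submodule.mem_iSup_iff_exists_finsupp] at hv
  obtain ⟨f, hf, rfl⟩ := hv
  have hort : ∀ i j : Set.Ici c, i ≠ j → inner ℂ (f i) (f j) = 0 := fun i j hij =>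
    inner_eq_zero_of_mem_eigSpace hT (fun h => hij (Subtype.ext h)) (hf i) (hf j)
  have key : ∀ g : Set.Ici c → ℂ,
      inner ℂ (∑ i ∈ f.support, g i • f i) (∑ i ∈ f.support, f i)
        = ∑ i ∈ f.support, (starRingEnd ℂ) (g i) * inner ℂ (f i) (f i) := by
    intro g
    simp only [sum_inner, inner_sum, inner_smul_left]
    refine Finset.sum_congr rfl fun i hi => ?_
    rw [Finset.sum_eq_single_of_mem i hi]
    intro j _ hj
    rw [hort j i hj, mul_zero]
  have hTs : T (f.sum fun _ x => x) = ∑ i ∈ f.support, ((i : ℝ) : ℂ) • f i := by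
    rw [Finsupp.sum, map_sum]
    exact Finset.sum_congr rfl fun i _ => mem_eigSpace.1 (hf i)
  have h1 := key fun _ => 1
  simp only [one_smul, map_one, one_mul] at h1
  have hnorm : ‖f.sum fun _ x => x‖ ^ 2 = ∑ i ∈ f.support, ‖f i‖ ^ 2 := by
    have := congrArg Complex.re h1
    simp only [inner_self_eq_norm_sq_to_K, Complex.coe_algebraMap, ← Complex.ofReal_pow,
      Complex.re_sum, Complex.ofReal_re] at this
    exact this
  rw [hTs, hnorm, Finsupp.sum, key, Complex.re_sum, Finset.mul_sum]
  refine Finset.sum_le_sum fun i _ => ?_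
  have h2 : ((starRingEnd ℂ) ((i : ℝ) : ℂ) * inner ℂ (f i) (f i)).re = i * ‖f i‖ ^ 2 := by
    rw [Complex.conj_ofReal, Complex.re_ofReal_mul]
    exact congrArg _ (inner_self_eq_norm_sq (𝕜 := ℂ) (f i))
  rw [h2]
  exact mul_le_mul_of_nonneg_right i.2 (by positivity)

/-- On the orthogonal complement of the eigenspaces for eigenvalues `≥ c`, the quadratic form of a
compact self-adjoint operator is strictly below `c`: by the spectral theorem, every vector is the
sum of its components in the remaining eigenspaces. -/
theorem re_inner_lt_of_mem_orthogonal [CompleteSpace E] {T : E →L[ℂ] E} (hTc : IsCompactOperator T)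
    (hT : (T : E →ₗ[ℂ] E).IsSymmetric) {c : ℝ} {v : E} (hv : v ∈ (specSpace T (Set.Ici c))ᗮ) (hv0 : v ≠ 0) :
    (inner ℂ (T v) v).re < c * ‖v‖ ^ 2 := by
  classical
  have hcl : ∀ μ : ℂ, IsClosed (Module.End.eigenspace (T : E →ₗ[ℂ] E) μ : Set E) := by
    intro μ
    have : (Module.End.eigenspace (T : E →ₗ[ℂ] E) μ : Set E) = {x | T x = μ • x} := by
      ext x; exact Module.End.mem_eigenspace_iff
    rw [this]
    exact isClosed_eq T.continuous (continuous_const_smul μ)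
  have : ∀ μ : ℂ, CompleteSpace (Module.End.eigenspace (T : E →ₗ[ℂ] E) μ) :=
    fun μ => (hcl μ).completeSpace_coe
  have hsum : IsHilbertSum ℂ (fun μ : ℂ => Module.End.eigenspace (T : E →ₗ[ℂ] E) μ)
      (fun μ => (Module.End.eigenspace (T : E →ₗ[ℂ] E) μ).subtypeₗᵢ) := by
    refine IsHilbertSum.mkInternal _ hT.orthogonalFamily_eigenspaces ?_
    rw [top_le_iff, Submodule.topologicalClosure_eq_top_iff]
    exact ContinuousLinearMap.orthogonalComplement_iSup_eigenspaces_eq_bot hTc hT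
  set w := hsum.linearIsometryEquiv v with hw
  have hvw : HasSum (fun μ => ((w μ : Module.End.eigenspace (T : E →ₗ[ℂ] E) μ) : E)) v := by
    have := hsum.hasSum_linearIsometryEquiv_symm w
    rwa [hw, LinearIsometryEquiv.symm_apply_apply] at this
  have hin : ∀ μ, inner ℂ v (w μ : E) = ((‖w μ‖ ^ 2 : ℝ) : ℂ) := by
    intro μ
    have h1 := hsum.linearIsometryEquiv_symm_apply_single (w μ)
    have h2 : hsum.linearIsometryEquiv.symm w = v := by
      rw [hw, LinearIsometryEquiv.symm_apply_apply]
    have h3 : inner ℂ v (w μ : E) = inner ℂ w (lp.single 2 μ (w μ)) := by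
      rw [← hsum.linearIsometryEquiv.symm.inner_map_map, h1, h2]; rfl
    rw [h3, lp.inner_single_right, inner_self_eq_norm_sq_to_K]
    simp
  have hT1 : ∀ μ, T (w μ : E) = μ • (w μ : E) := fun μ =>
    Module.End.mem_eigenspace_iff.1 (w μ).2
  have hre : ∀ μ, w μ ≠ 0 → ∃ r : ℝ, r < c ∧ μ = r := by
    intro μ hμ
    have hμ' : (w μ : E) ≠ 0 := by simpa using hμ
    have hr := hT.conj_eigenvalue_eq_self (Module.End.hasEigenvalue_of_hasEigenvector
      (⟨(w μ).2, hμ'⟩ : Module.End.HasEigenvector (T : E →ₗ[ℂ] E) μ (w μ : E)))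
    obtain ⟨r, rfl⟩ := Complex.conj_eq_iff_real.1 hr
    refine ⟨r, ?_, rfl⟩
    by_contra! hrc
    have := (Submodule.mem_orthogonal' _ _).1 hv (w (r : ℂ))
      (eigSpace_le_specSpace T (Set.mem_Ici.2 hrc) (w (r : ℂ)).2)
    rw [hin] at this
    exact hμ (by simpa using this)
  have hs1 : HasSum (fun μ => c * ‖w μ‖ ^ 2) (c * ‖v‖ ^ 2) := by
    refine HasSum.mul_left c ?_
    have := (hvw.mapL (innerSL ℂ v)).mapL Complex.reCLM
    simp only [innerSL_apply_apply, hin, Complex.reCLM_apply, Complex.ofReal_re,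
      inner_self_eq_norm_sq_to_K, Complex.coe_algebraMap, ← Complex.ofReal_pow] at this
    exact this
  have hs2 : HasSum (fun μ : ℂ => μ.re * ‖w μ‖ ^ 2) (inner ℂ (T v) v).re := by
    have := (hvw.mapL (innerSL ℂ (T v))).mapL Complex.reCLM
    simp only [innerSL_apply_apply, Complex.reCLM_apply] at this
    convert this using 2 with μ
    have h := hT v (w μ : E)
    simp only [ContinuousLinearMap.coe_coe] at h
    rw [h, hT1, inner_smul_right, hin, Complex.re_mul_ofReal]
  obtain ⟨μ, hμ⟩ : ∃ μ, w μ ≠ 0 := by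
    by_contra! h
    have h0 : HasSum (fun μ => ((w μ : Module.End.eigenspace (T : E →ₗ[ℂ] E) μ) : E)) 0 := by
      simp [h]
    exact hv0 (hvw.unique h0)
  refine hasSum_lt (i := μ) (fun ν => ?_) ?_ hs2 hs1
  · by_cases hν : w ν = 0
    · simp [hν]
    · obtain ⟨r, hr, hνr⟩ := hre ν hν
      have h1 : ν.re = r := by rw [hνr, Complex.ofReal_re]
      show ν.re * _ ≤ _
      rw [h1]
      exact mul_le_mul_of_nonneg_right hr.le (by positivity)
  · obtain ⟨r, hr, hνr⟩ := hre μ hμ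
    have h1 : μ.re = r := by rw [hνr, Complex.ofReal_re]
    show μ.re * _ < _
    rw [h1]
    exact mul_lt_mul_of_pos_right hr (by have := norm_pos_iff.2 hμ; positivity)

/-- A subspace meets the orthogonal complement of every subspace of smaller dimension. -/
theorem exists_ne_zero_mem_orthogonal (W P : Submodule ℂ E) [FiniteDimensional ℂ W]
    [FiniteDimensional ℂ P] (h : Module.finrank ℂ P < Module.finrank ℂ W) :
    ∃ v ∈ W, v ∈ Pᗮ ∧ v ≠ 0 := by
  have hk := LinearMap.ker_ne_bot_of_finrank_lt
    (f := (P.orthogonalProjectionOnto : E →ₗ[ℂ] P) ∘ₗ W.subtype) h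
  obtain ⟨v, hv, hv0⟩ := Submodule.exists_mem_ne_zero_of_ne_bot hk
  refine ⟨v, v.2, ?_, by simpa using hv0⟩
  have : P.orthogonalProjectionOnto (v : E) = 0 := by simpa using hv
  exact Submodule.orthogonalProjectionOnto_eq_zero_iff.1 this

theorem exists_submodule_of_le_rank {M : Submodule ℂ E} {j : ℕ}
    (h : (j : Cardinal) ≤ Module.rank ℂ M) :
    ∃ W ≤ M, FiniteDimensional ℂ W ∧ Module.finrank ℂ W = j := by
  obtain ⟨v, hv⟩ := Module.le_rank_iff.1 h
  have hv' : LinearIndependent ℂ (fun i => (v i : E)) :=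
    hv.map' M.subtype (Submodule.ker_subtype M)
  refine ⟨Submodule.span ℂ (Set.range fun i => (v i : E)), ?_, ?_, ?_⟩
  · rw [Submodule.span_le]
    rintro _ ⟨i, rfl⟩
    exact (v i).2
  · exact FiniteDimensional.span_of_finite ℂ (Set.finite_range _)
  · simpa using finrank_span_eq_card hv'

/-- The Courant-Fischer principle in counting form: at least `j` eigenvalues of a compact
self-adjoint operator are `≥ c` if and only if its quadratic form is at least `c` on some subspace
of dimension `j`. -/
theorem le_eigCount_Ici_iff [CompleteSpace E] {T : E →L[ℂ] E} (hTc : IsCompactOperator T)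
    (hT : (T : E →ₗ[ℂ] E).IsSymmetric) {c : ℝ} {j : ℕ} :
    (j : Cardinal) ≤ eigCount T (Set.Ici c) ↔
      ∃ W : Submodule ℂ E, FiniteDimensional ℂ W ∧ Module.finrank ℂ W = j ∧
        ∀ v ∈ W, c * ‖v‖ ^ 2 ≤ (inner ℂ (T v) v).re := by
  constructor
  · intro h
    obtain ⟨W, hWM, hW, hWj⟩ := exists_submodule_of_le_rank (M := specSpace T (Set.Ici c)) h
    exact ⟨W, hW, hWj, fun v hv => le_re_inner_of_mem_specSpace hT (hWM hv)⟩
  · rintro ⟨W, hW, hWj, hWc⟩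
    by_contra! hlt
    rw [eigCount_eq] at hlt
    have : FiniteDimensional ℂ (specSpace T (Set.Ici c)) :=
      Module.rank_lt_aleph0_iff.1 (hlt.trans Cardinal.natCast_lt_aleph0)
    rw [← Module.finrank_eq_rank, Nat.cast_lt, ← hWj] at hlt
    obtain ⟨v, hvW, hvP, hv0⟩ := exists_ne_zero_mem_orthogonal W _ hlt
    exact absurd (hWc v hvW) (not_le.2 (re_inner_lt_of_mem_orthogonal hTc hT hvP hv0))

theorem bddAbove_eigCount {T : E →L[ℂ] E} (hT : (T : E →ₗ[ℂ] E).IsSymmetric) {j : ℕ} (hj : 1 ≤ j) :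
    BddAbove {x : ℝ | (j : Cardinal) ≤ eigCount T (Set.Ici x)} := by
  refine ⟨‖T‖, fun x hx => ?_⟩
  obtain ⟨W, hWM, hW, hWj⟩ := exists_submodule_of_le_rank (M := specSpace T (Set.Ici x)) hx
  have : Nontrivial W := Module.nontrivial_of_finrank_pos (R := ℂ) (by omega)
  obtain ⟨v, hv⟩ := exists_ne (0 : W)
  have hv0 : 0 < ‖(v : E)‖ := by simpa using hv
  have h1 := le_re_inner_of_mem_specSpace hT (hWM v.2)
  have h2 : (inner ℂ (T v) (v : E)).re ≤ ‖T‖ * ‖(v : E)‖ ^ 2 := by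
    refine (Complex.re_le_norm _).trans ((norm_inner_le_norm _ _).trans ?_)
    rw [sq, ← mul_assoc]
    exact mul_le_mul_of_nonneg_right (T.le_opNorm _) (norm_nonneg _)
  exact le_of_mul_le_mul_right (h1.trans h2) (by positivity)

theorem le_eigLargest {T : E →L[ℂ] E} (hT : (T : E →ₗ[ℂ] E).IsSymmetric) {j : ℕ} (hj : 1 ≤ j) {x : ℝ}
    (hx : (j : Cardinal) ≤ eigCount T (Set.Ici x)) : x ≤ eigLargest T j :=
  le_csSup (bddAbove_eigCount hT hj) hx

/-- Since finitely many vectors of the span of the eigenspaces for eigenvalues `> a` involve only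
finitely many eigenvalues, they lie in the span of the eigenspaces for eigenvalues `≥ x` for
some `x > a`. -/
theorem exists_le_eigCount_Ici {T : E →L[ℂ] E} {a : ℝ} {j : ℕ}
    (h : (j : Cardinal) ≤ eigCount T (Set.Ioi a)) :
    ∃ x, a < x ∧ (j : Cardinal) ≤ eigCount T (Set.Ici x) := by
  obtain ⟨W, hWM, hW, hWj⟩ := exists_submodule_of_le_rank (M := specSpace T (Set.Ioi a)) h
  have hle : W ≤ ⨆ x : Set.Ioi a, specSpace T (Set.Ici (x : ℝ)) :=
    hWM.trans (iSup₂_le fun μ hμ =>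
      (eigSpace_le_specSpace T Set.self_mem_Ici).trans
        (le_iSup (fun x : Set.Ioi a => specSpace T (Set.Ici (x : ℝ))) ⟨μ, hμ⟩))
  have hdir : Directed (· ≤ ·) fun x : Set.Ioi a => specSpace T (Set.Ici (x : ℝ)) := by
    intro x y
    refine ⟨⟨min x y, Set.mem_Ioi.2 (lt_min x.2 y.2)⟩, ?_, ?_⟩
    · exact specSpace_mono T (Set.Ici_subset_Ici.2 (min_le_left _ _))
    · exact specSpace_mono T (Set.Ici_subset_Ici.2 (min_le_right _ _))
  have : Nonempty (Set.Ioi a) := ⟨⟨a + 1, by simp⟩⟩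
  obtain ⟨x, hx⟩ := (CompleteLattice.isCompactElement_iff_le_of_directed_sSup_le _ _).1
    ((Submodule.fg_iff_compact W).1 ((Submodule.fg_iff_finiteDimensional W).2 hW))
    (Set.range fun x : Set.Ioi a => specSpace T (Set.Ici (x : ℝ))) (Set.range_nonempty _)
    hdir.directedOn_range (by rwa [sSup_range])
  obtain ⟨⟨x, rfl⟩, hWx⟩ := hx
  refine ⟨x, x.2, ?_⟩
  rw [← hWj, Module.finrank_eq_rank]
  exact Submodule.rank_mono hWx

theorem lt_eigLargest {T : E →L[ℂ] E} (hT : (T : E →ₗ[ℂ] E).IsSymmetric) {j : ℕ} (hj : 1 ≤ j) {a : ℝ}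
    (h : (j : Cardinal) ≤ eigCount T (Set.Ioi a)) : a < eigLargest T j := by
  obtain ⟨x, hax, hx⟩ := exists_le_eigCount_Ici h
  exact hax.trans_le (le_eigLargest hT hj hx)

/-- The span of the eigenspaces of a compact operator for eigenvalues bounded away from `0` is
finite-dimensional. -/
theorem finiteDimensional_specSpace [CompleteSpace E] {T : E →L[ℂ] E} (hTc : IsCompactOperator T)
    (hT : (T : E →ₗ[ℂ] E).IsSymmetric) {c : ℝ} (hc : 0 < c) :
    FiniteDimensional ℂ (specSpace T (Set.Ici c)) := by
  set M := (specSpace T (Set.Ici c)).topologicalClosure with hM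
  -- `T` is bounded below on the span, hence on its closure
  have hlow : ∀ v ∈ M, c * ‖v‖ ≤ ‖T v‖ := by
    have hclosed : IsClosed {v : E | c * ‖v‖ ≤ ‖T v‖} :=
      isClosed_le (by fun_prop) (by fun_prop)
    intro v hv
    refine closure_minimal (fun v hv => ?_) hclosed hv
    rcases eq_or_ne v 0 with rfl | hv0
    · simp
    have h1 := le_re_inner_of_mem_specSpace hT hv
    have h2 : (inner ℂ (T v) v).re ≤ ‖T v‖ * ‖v‖ :=
      (Complex.re_le_norm _).trans (norm_inner_le_norm _ _)
    have hv' : 0 < ‖v‖ := norm_pos_iff.2 hv0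
    refine le_of_mul_le_mul_right ?_ hv'
    calc c * ‖v‖ * ‖v‖ = c * ‖v‖ ^ 2 := by ring
      _ ≤ _ := h1.trans h2
  have : CompleteSpace M :=
    (Submodule.isClosed_topologicalClosure (specSpace T (Set.Ici c))).completeSpace_coe
  have hanti : AntilipschitzWith (Real.toNNReal c⁻¹) (T ∘L M.subtypeL) := by
    refine ContinuousLinearMap.antilipschitz_of_bound _ fun v => ?_
    rw [Real.coe_toNNReal _ (by positivity), inv_mul_eq_div, le_div_iff₀ hc, mul_comm]
    exact hlow v v.2
  have hemb := hanti.isClosedEmbedding (T ∘L M.subtypeL).uniformContinuous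
  obtain ⟨K, hK, hsubK⟩ := hTc.image_closedBall_subset_compact (f := (T : E →ₗ[ℂ] E)) 1
  have hball : IsCompact (Metric.closedBall (0 : M) 1) := by
    refine (hemb.isCompact_preimage hK).of_isClosed_subset Metric.isClosed_closedBall ?_
    intro v hv
    exact hsubK ⟨v, by simpa using hv, rfl⟩
  have : FiniteDimensional ℂ M := FiniteDimensional.of_isCompact_closedBall ℂ one_pos hball
  exact Submodule.finiteDimensional_of_le (Submodule.le_topologicalClosure _)

theorem mem_orthogonal_specSpace {T : E →L[ℂ] E} (hT : (T : E →ₗ[ℂ] E).IsSymmetric) {I : Set ℝ}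
    {μ : ℝ} (hμ : μ ∉ I) {v : E} (hv : v ∈ eigSpace T μ) : v ∈ (specSpace T I)ᗮ := by
  rw [Submodule.mem_orthogonal]
  intro u hu
  have hle : specSpace T I ≤ (Submodule.span ℂ {v})ᗮ := by
    refine iSup₂_le fun ν hν w hw => ?_
    rw [Submodule.mem_orthogonal_singleton_iff_inner_left]
    exact inner_eq_zero_of_mem_eigSpace hT (by rintro rfl; exact hμ hν) hw hv
  exact Submodule.mem_orthogonal_singleton_iff_inner_left.1 (hle hu)

/-- The positive eigenvalues of a compact self-adjoint operator do not accumulate from below at a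
positive number. -/
theorem exists_specSpace_gap [CompleteSpace E] {T : E →L[ℂ] E} (hTc : IsCompactOperator T)
    (hT : (T : E →ₗ[ℂ] E).IsSymmetric) {c : ℝ} (hc : 0 < c) :
    ∃ x < c, specSpace T (Set.Ici x) = specSpace T (Set.Ici c) := by
  -- take `x` for which the dimension is smallest: below `c`, the dimension is constant from `x` on
  have hne : (Set.Ioo 0 c).Nonempty := Set.nonempty_Ioo.2 hc
  obtain ⟨x, hx, hmin⟩ := WellFounded.has_min
    (InvImage.wf (fun x => Module.finrank ℂ (specSpace T (Set.Ici x))) Nat.lt_wfRel.wf) _ hne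
  refine ⟨x, hx.2, le_antisymm (iSup₂_le fun μ hμ => ?_)
    (specSpace_mono T (Set.Ici_subset_Ici.2 hx.2.le))⟩
  rcases le_or_gt c μ with h | h
  · exact eigSpace_le_specSpace T h
  have hxμ : x ≤ μ := hμ
  have hx0 : 0 < x := hx.1
  have := finiteDimensional_specSpace hTc hT hx.1
  have heq : specSpace T (Set.Ici ((μ + c) / 2)) = specSpace T (Set.Ici x) := by
    refine Submodule.eq_of_le_of_finrank_le
      (specSpace_mono T (Set.Ici_subset_Ici.2 (by linarith))) ?_
    exact not_lt.1 (hmin _ ⟨by linarith, by linarith⟩)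
  intro v hv
  have h1 : v ∈ specSpace T (Set.Ici ((μ + c) / 2)) := heq ▸ eigSpace_le_specSpace T hμ hv
  have h2 := mem_orthogonal_specSpace hT (I := Set.Ici ((μ + c) / 2))
    (by simp only [Set.mem_Ici, not_le]; linarith) hv
  rw [inner_self_eq_zero.1 ((Submodule.mem_orthogonal _ _).1 h2 v h1)]
  exact Submodule.zero_mem _

end Eigenvalues

/-! ### First order perturbation of a simple eigenvalue -/

section Perturbation

variable {E : Type} [NormedAddCommGroup E] [InnerProductSpace ℂ E]

/-- Data isolating the simple eigenvalue number `n + 1` of `T`, counted from the top: independent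
eigenvectors `t` for `n` eigenvalues `≥ c + γ`, a unit eigenvector `u` for the eigenvalue `c`, and
the bound `c - γ` for the quadratic form of `T` on the orthogonal complement of these vectors. -/
structure SpectralGap (T : E →L[ℂ] E) (c γ : ℝ) {n : ℕ} (t : Fin n → E) (u : E) : Prop where
  pos : 0 < γ
  norm_eq_one : ‖u‖ = 1
  mem_eigSpace : u ∈ eigSpace T c
  linearIndependent : LinearIndependent ℂ t
  above : ∀ i, ∃ μ, c + γ ≤ μ ∧ t i ∈ eigSpace T μ
  below : ∀ w, (∀ i, inner ℂ (t i) w = 0) → inner ℂ u w = 0 →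
    (inner ℂ (T w) w).re ≤ (c - γ) * ‖w‖ ^ 2

namespace SpectralGap

variable {T : E →L[ℂ] E} {c γ : ℝ} {n : ℕ} {t : Fin n → E} {u : E}

theorem inner_eq_zero (h : SpectralGap T c γ t u) (hT : (T : E →ₗ[ℂ] E).IsSymmetric) (i : Fin n)
    {v : E} (hv : v ∈ eigSpace T c) : inner ℂ (t i) v = 0 := by
  obtain ⟨μ, hμ, hi⟩ := h.above i
  exact inner_eq_zero_of_mem_eigSpace hT (by have := h.pos; intro h; linarith) hi hv

theorem span_le_specSpace (h : SpectralGap T c γ t u) :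
    Submodule.span ℂ (Set.range t) ≤ specSpace T (Set.Ici (c + γ)) := by
  rw [Submodule.span_le]
  rintro _ ⟨i, rfl⟩
  obtain ⟨μ, hμ, hi⟩ := h.above i
  exact eigSpace_le_specSpace T hμ hi

theorem isSimpleEig (h : SpectralGap T c γ t u) (hT : (T : E →ₗ[ℂ] E).IsSymmetric) :
    IsSimpleEig T c := by
  have hu0 : u ≠ 0 := norm_pos_iff.1 (by rw [h.norm_eq_one]; exact one_pos)
  have hle : eigSpace T c = Submodule.span ℂ {u} := by
    refine le_antisymm (fun v hv => ?_) ?_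
    · rw [Submodule.mem_span_singleton]
      refine ⟨inner ℂ u v, ?_⟩
      set w := v - (inner ℂ u v : ℂ) • u with hw
      have hwc : w ∈ eigSpace T c :=
        Submodule.sub_mem _ hv (Submodule.smul_mem _ _ h.mem_eigSpace)
      have huw : inner ℂ u w = 0 := by
        rw [hw, inner_sub_right, inner_smul_right, inner_self_eq_norm_sq_to_K, h.norm_eq_one]
        simp
      have hb := h.below w (fun i => h.inner_eq_zero hT i hwc) huw
      rw [re_inner_eigenvector hwc] at hb
      have hw0 : ‖w‖ ^ 2 ≤ 0 := by
        have := h.pos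
        by_contra! hlt
        nlinarith
      have : w = 0 := by simpa using le_antisymm hw0 (by positivity)
      exact (sub_eq_zero.1 (hw ▸ this)).symm
    · rw [Submodule.span_singleton_le_iff_mem]
      exact h.mem_eigSpace
  rw [IsSimpleEig, hle]
  exact finrank_span_singleton hu0

end SpectralGap

theorem norm_sq_add_smul {u p : E} (hu : ‖u‖ = 1) (hup : inner ℂ u p = 0) (a : ℂ) :
    ‖p + a • u‖ ^ 2 = ‖p‖ ^ 2 + ‖a‖ ^ 2 := by
  have h : inner ℂ p (a • u) = 0 := by
    rw [inner_smul_right, inner_eq_zero_symm.1 hup, mul_zero]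
  have := norm_add_sq_eq_norm_sq_add_norm_sq_of_inner_eq_zero (𝕜 := ℂ) p (a • u) h
  rw [norm_smul, hu, mul_one] at this
  simpa only [sq] using this

/-- The quadratic form of a perturbation `T'` of `T` along an eigenvector `u` of `T` and a vector
`p` orthogonal to it: there is no mixed term of order zero. -/
theorem abs_re_inner_perturbation_le {T T' : E →L[ℂ] E} (hT : (T : E →ₗ[ℂ] E).IsSymmetric)
    {c : ℝ} {u p : E} (hu : ‖u‖ = 1) (huc : u ∈ eigSpace T c) (hup : inner ℂ u p = 0) (a : ℂ) :
    |(inner ℂ (T' (p + a • u)) (p + a • u)).re -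
        ((inner ℂ (T p) p).re + (c + (inner ℂ ((T' - T) u) u).re) * ‖a‖ ^ 2)| ≤
      ‖T' - T‖ * ‖p‖ ^ 2 + 2 * ‖T' - T‖ * ‖p‖ * ‖a‖ := by
  set H := T' - T with hH
  have hT' : T' = T + H := by rw [hH]; abel
  have hTu : T u = (c : ℂ) • u := mem_eigSpace.1 huc
  have hpu : inner ℂ p u = 0 := inner_eq_zero_symm.1 hup
  have hTpu : inner ℂ (T p) u = 0 := by
    have := hT p u
    simp only [ContinuousLinearMap.coe_coe] at this
    rw [this, hTu, inner_smul_right, hpu, mul_zero]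
  have haa : (starRingEnd ℂ) a * a = ((‖a‖ ^ 2 : ℝ) : ℂ) := by
    rw [← Complex.normSq_eq_conj_mul_self, Complex.normSq_eq_norm_sq]
  have huu : inner ℂ u u = (1 : ℂ) := by
    rw [inner_self_eq_norm_sq_to_K, hu]; simp
  have hexp : inner ℂ (T' (p + a • u)) (p + a • u) =
      inner ℂ (T p) p + ((‖a‖ ^ 2 : ℝ) : ℂ) * (c + inner ℂ (H u) u)
        + (inner ℂ (H p) p + inner ℂ (H p) (a • u) + inner ℂ (H (a • u)) p) := by
    rw [hT', ← haa]
    simp only [add_apply, map_add, map_smul, hTu, inner_add_left,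
      inner_add_right, inner_smul_left, inner_smul_right, hTpu, hup, huu, Complex.conj_ofReal]
    ring
  have hre : (inner ℂ (T' (p + a • u)) (p + a • u)).re -
        ((inner ℂ (T p) p).re + (c + (inner ℂ (H u) u).re) * ‖a‖ ^ 2) =
      (inner ℂ (H p) p + inner ℂ (H p) (a • u) + inner ℂ (H (a • u)) p).re := by
    rw [hexp, Complex.add_re, Complex.add_re, Complex.re_ofReal_mul, Complex.add_re,
      Complex.ofReal_re]
    ring
  have hb : ∀ x y : E, ‖inner ℂ (H x) y‖ ≤ ‖H‖ * ‖x‖ * ‖y‖ := fun x y =>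
    (norm_inner_le_norm _ _).trans
      (mul_le_mul_of_nonneg_right (H.le_opNorm x) (norm_nonneg _))
  rw [hre]
  refine (Complex.abs_re_le_norm _).trans ((norm_add₃_le).trans ?_)
  have hau : ‖a • u‖ = ‖a‖ := by rw [norm_smul, hu, mul_one]
  have h1 := hb p p
  have h2 := hb p (a • u)
  have h3 := hb (a • u) p
  rw [hau] at h2 h3
  nlinarith

/-- First order perturbation of a simple eigenvalue: under a self-adjoint perturbation `H = T' - T`
the eigenvalue `c` with unit eigenvector `u` changes by `⟨H u, u⟩`, up to a term of second
order. -/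
theorem SpectralGap.abs_eigLargest_sub_le [CompleteSpace E] {T T' : E →L[ℂ] E} {c γ : ℝ} {n : ℕ}
    {t : Fin n → E} {u : E} (h : SpectralGap T c γ t u) (hT : (T : E →ₗ[ℂ] E).IsSymmetric)
    (hTc' : IsCompactOperator T') (hT' : (T' : E →ₗ[ℂ] E).IsSymmetric)
    (hTT' : ‖T' - T‖ ≤ γ / 4) :
    |eigLargest T' (n + 1) - (c + (inner ℂ ((T' - T) u) u).re)| ≤ 2 / γ * ‖T' - T‖ ^ 2 := by
  have hγ := h.pos
  set δ := ‖T' - T‖ with hδ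
  have hδ0 : 0 ≤ δ := norm_nonneg _
  set k := (inner ℂ ((T' - T) u) u).re with hk
  have hkδ : |k| ≤ δ := by
    refine (Complex.abs_re_le_norm _).trans ((norm_inner_le_norm _ _).trans ?_)
    have := (T' - T).le_opNorm u
    rw [h.norm_eq_one] at this ⊢
    linarith
  obtain ⟨hk1, hk2⟩ := abs_le.1 hkδ
  have hu0 : u ≠ 0 := norm_pos_iff.1 (by rw [h.norm_eq_one]; exact one_pos)
  -- the terms of first order in `δ` are absorbed by the gap
  have hquad : ∀ x y : ℝ, 2 * δ * x * y ≤ γ / 2 * x ^ 2 + 2 / γ * δ ^ 2 * y ^ 2 := by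
    intro x y
    have h1 : γ / 2 * x ^ 2 + 2 / γ * δ ^ 2 * y ^ 2 - 2 * δ * x * y
        = γ / 2 * (x - 2 / γ * δ * y) ^ 2 := by
      field_simp
      ring
    have h2 : 0 ≤ γ / 2 * (x - 2 / γ * δ * y) ^ 2 := by positivity
    linarith
  have hC : 0 ≤ 2 / γ * δ ^ 2 := by positivity
  have hP : FiniteDimensional ℂ (Submodule.span ℂ (Set.range t)) :=
    FiniteDimensional.span_of_finite ℂ (Set.finite_range _)
  have hPn : Module.finrank ℂ (Submodule.span ℂ (Set.range t)) = n := by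
    simpa using finrank_span_eq_card h.linearIndependent
  have hlow : ((n + 1 : ℕ) : Cardinal) ≤ eigCount T' (Set.Ici (c + k - 2 / γ * δ ^ 2)) := by
    rw [le_eigCount_Ici_iff hTc' hT']
    have hup : ∀ p ∈ Submodule.span ℂ (Set.range t), inner ℂ u p = 0 := by
      intro p hp
      have hle : Submodule.span ℂ (Set.range t) ≤ (Submodule.span ℂ {u})ᗮ := by
        rw [Submodule.span_le]
        rintro _ ⟨i, rfl⟩
        exact Submodule.mem_orthogonal_singleton_iff_inner_left.2
          (h.inner_eq_zero hT i h.mem_eigSpace)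
      exact Submodule.mem_orthogonal_singleton_iff_inner_right.1 (hle hp)
    refine ⟨Submodule.span ℂ (Set.range t) ⊔ Submodule.span ℂ {u}, inferInstance, ?_, ?_⟩
    · have hdisj : Submodule.span ℂ (Set.range t) ⊓ Submodule.span ℂ {u} = ⊥ := by
        rw [eq_bot_iff]
        rintro v ⟨hv1, hv2⟩
        obtain ⟨a, rfl⟩ := Submodule.mem_span_singleton.1 hv2
        have := hup _ hv1
        rw [inner_smul_right, mul_eq_zero, inner_self_eq_zero] at this
        rw [this.resolve_right hu0, zero_smul]
        exact Submodule.zero_mem _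
      have := Submodule.finrank_sup_add_finrank_inf_eq (Submodule.span ℂ (Set.range t))
        (Submodule.span ℂ {u})
      rwa [hdisj, finrank_bot, hPn, finrank_span_singleton hu0] at this
    · intro v hv
      obtain ⟨p, hp, y, hy, rfl⟩ := Submodule.mem_sup.1 hv
      obtain ⟨a, rfl⟩ := Submodule.mem_span_singleton.1 hy
      have h1 := (abs_le.1 (abs_re_inner_perturbation_le (T' := T') hT h.norm_eq_one
        h.mem_eigSpace (hup p hp) a)).1
      have h2 := le_re_inner_of_mem_specSpace hT (h.span_le_specSpace hp)
      have h3 := hquad ‖p‖ ‖a‖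
      rw [norm_sq_add_smul h.norm_eq_one (hup p hp)]
      rw [← hδ, ← hk] at h1
      have h4 : 0 ≤ (γ / 2 - δ - k) * ‖p‖ ^ 2 :=
        mul_nonneg (by linarith) (by positivity)
      have h5 : 0 ≤ 2 / γ * δ ^ 2 * ‖p‖ ^ 2 := by positivity
      linarith
  have hupp : eigLargest T' (n + 1) ≤ c + k + 2 / γ * δ ^ 2 := by
    refine csSup_le ⟨_, hlow⟩ fun x hx => ?_
    obtain ⟨W, hW, hWn, hWx⟩ := (le_eigCount_Ici_iff hTc' hT').1 hx
    obtain ⟨v, hvW, hvP, hv0⟩ := exists_ne_zero_mem_orthogonal W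
      (Submodule.span ℂ (Set.range t)) (by omega)
    have hxv := hWx v hvW
    have hvt : ∀ i, inner ℂ (t i) v = 0 := fun i =>
      (Submodule.mem_orthogonal _ _).1 hvP _ (Submodule.subset_span ⟨i, rfl⟩)
    obtain ⟨p, a, rfl, hpt, hup⟩ : ∃ (p : E) (a : ℂ), v = p + a • u ∧
        (∀ i, inner ℂ (t i) p = 0) ∧ inner ℂ u p = 0 := by
      refine ⟨v - (inner ℂ u v : ℂ) • u, inner ℂ u v, by abel, fun i => ?_, ?_⟩
      · rw [inner_sub_right, inner_smul_right, hvt, h.inner_eq_zero hT i h.mem_eigSpace]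
        simp
      · rw [inner_sub_right, inner_smul_right, inner_self_eq_norm_sq_to_K, h.norm_eq_one]
        simp
    have h1 := (abs_le.1 (abs_re_inner_perturbation_le (T' := T') hT h.norm_eq_one
      h.mem_eigSpace hup a)).2
    have h2 := h.below p hpt hup
    have h3 := hquad ‖p‖ ‖a‖
    have hv : 0 < ‖p + a • u‖ ^ 2 := by have := norm_pos_iff.2 hv0; positivity
    refine le_of_mul_le_mul_right (hxv.trans ?_) hv
    rw [norm_sq_add_smul h.norm_eq_one hup]
    rw [← hδ, ← hk] at h1
    have h4 : 0 ≤ (γ / 2 - δ + k) * ‖p‖ ^ 2 :=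
      mul_nonneg (by linarith) (by positivity)
    have h5 : 0 ≤ 2 / γ * δ ^ 2 * ‖p‖ ^ 2 := by positivity
    linarith
  have := le_eigLargest hT' (by omega) hlow
  rw [abs_le]
  constructor <;> linarith

end Perturbation

/-! ### Compressions by isometries -/

section Compression

theorem norm_map_eq {E F : Type} [NormedAddCommGroup E] [InnerProductSpace ℂ E]
    [NormedAddCommGroup F] [InnerProductSpace ℂ F] {V : F →L[ℂ] E}
    (hV : ∀ x y, inner ℂ (V x) (V y) = inner ℂ x y) (x : F) : ‖V x‖ = ‖x‖ := by
  rw [norm_eq_sqrt_re_inner (𝕜 := ℂ), norm_eq_sqrt_re_inner (𝕜 := ℂ) x, hV]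

variable {E F : Type} [NormedAddCommGroup E] [InnerProductSpace ℂ E] [CompleteSpace E]
  [NormedAddCommGroup F] [InnerProductSpace ℂ F] [CompleteSpace F]

/-- The compression `V* T V` of the operator `T` by `V`. -/
def compression (V : F →L[ℂ] E) (T : E →L[ℂ] E) : F →L[ℂ] F :=
  ContinuousLinearMap.adjoint V ∘L T ∘L V

variable {V : F →L[ℂ] E} {T : E →L[ℂ] E}

theorem inner_compression (x y : F) :
    inner ℂ (compression V T x) y = inner ℂ (T (V x)) (V y) := by
  simp [compression, ContinuousLinearMap.adjoint_inner_left]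

theorem isSymmetric_compression (hT : (T : E →ₗ[ℂ] E).IsSymmetric) :
    (compression V T : F →ₗ[ℂ] F).IsSymmetric := by
  intro x y
  have h := hT (V x) (V y)
  simp only [ContinuousLinearMap.coe_coe] at h ⊢
  rw [inner_compression, h, ← inner_conj_symm x, inner_compression, inner_conj_symm]

theorem isCompactOperator_compression (hT : IsCompactOperator T) :
    IsCompactOperator (compression V T) :=
  (hT.comp_clm V).clm_comp (ContinuousLinearMap.adjoint V)

theorem compression_sub (T' : E →L[ℂ] E) :
    compression V T' - compression V T = compression V (T' - T) := by
  ext x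
  simp [compression]

theorem norm_compression_le (hV : ∀ x y, inner ℂ (V x) (V y) = inner ℂ x y) :
    ‖compression V T‖ ≤ ‖T‖ := by
  have hV1 : ‖V‖ ≤ 1 :=
    V.opNorm_le_bound zero_le_one fun x => by rw [norm_map_eq hV, one_mul]
  have hV2 : ‖ContinuousLinearMap.adjoint V‖ ≤ 1 := by
    rwa [LinearIsometryEquiv.norm_map]
  calc ‖compression V T‖ ≤ ‖ContinuousLinearMap.adjoint V‖ * (‖T‖ * ‖V‖) :=
        (ContinuousLinearMap.opNorm_comp_le _ _).trans
          (mul_le_mul_of_nonneg_left (ContinuousLinearMap.opNorm_comp_le _ _) (norm_nonneg _))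
    _ ≤ 1 * (‖T‖ * 1) := by gcongr
    _ = ‖T‖ := by ring

theorem mem_eigSpace_compression (hV : ∀ x y, inner ℂ (V x) (V y) = inner ℂ x y) {μ : ℝ} {x : F}
    (hx : V x ∈ eigSpace T μ) : x ∈ eigSpace (compression V T) μ := by
  rw [mem_eigSpace] at hx ⊢
  refine ext_inner_right ℂ fun y => ?_
  rw [inner_compression, hx, inner_smul_left, inner_smul_left, hV]

/-- A compression has at most as many eigenvalues above a given bound as the operator itself. -/
theorem le_eigCount_of_compression (hV : ∀ x y, inner ℂ (V x) (V y) = inner ℂ x y)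
    (hTc : IsCompactOperator T) (hT : (T : E →ₗ[ℂ] E).IsSymmetric) {c : ℝ} {j : ℕ}
    (h : (j : Cardinal) ≤ eigCount (compression V T) (Set.Ici c)) :
    (j : Cardinal) ≤ eigCount T (Set.Ici c) := by
  rw [le_eigCount_Ici_iff (isCompactOperator_compression hTc) (isSymmetric_compression hT)] at h
  obtain ⟨W, hW, hWj, hWc⟩ := h
  rw [le_eigCount_Ici_iff hTc hT]
  have hinj : Function.Injective (V : F →ₗ[ℂ] E) := by
    refine (injective_iff_map_eq_zero _).2 fun x hx => ?_
    rw [← norm_eq_zero, ← norm_map_eq hV]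
    simpa using hx
  refine ⟨W.map (V : F →ₗ[ℂ] E), inferInstance, ?_, ?_⟩
  · rw [← hWj]
    exact (Submodule.equivMapOfInjective _ hinj W).finrank_eq.symm
  · rintro _ ⟨x, hx, rfl⟩
    rw [ContinuousLinearMap.coe_coe, norm_map_eq hV, ← inner_compression]
    exact hWc x hx

/-- The `j`th largest eigenvalue is preserved by compression to a space that contains `j`
independent eigenvectors for eigenvalues at least as large. -/
theorem eigLargest_compression (hV : ∀ x y, inner ℂ (V x) (V y) = inner ℂ x y)
    (hTc : IsCompactOperator T) (hT : (T : E →ₗ[ℂ] E).IsSymmetric) {j : ℕ} (hj : 1 ≤ j)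
    {t : Fin j → F} (ht : LinearIndependent ℂ t)
    (hmem : ∀ i, ∃ μ, eigLargest T j ≤ μ ∧ V (t i) ∈ eigSpace T μ) :
    eigLargest (compression V T) j = eigLargest T j := by
  have hlow : (j : Cardinal) ≤ eigCount (compression V T) (Set.Ici (eigLargest T j)) := by
    have hle : Submodule.span ℂ (Set.range t) ≤
        specSpace (compression V T) (Set.Ici (eigLargest T j)) := by
      rw [Submodule.span_le]
      rintro _ ⟨i, rfl⟩
      obtain ⟨μ, hμ, hi⟩ := hmem i
      exact eigSpace_le_specSpace _ hμ (mem_eigSpace_compression hV hi)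
    have h := Submodule.rank_mono hle
    have := FiniteDimensional.span_of_finite ℂ (Set.finite_range t)
    rwa [← Module.finrank_eq_rank, finrank_span_eq_card ht, Fintype.card_fin] at h
  refine le_antisymm ?_ (le_eigLargest (isSymmetric_compression hT) hj hlow)
  exact csSup_le ⟨_, hlow⟩ fun x hx =>
    le_eigLargest hT hj (le_eigCount_of_compression hV hTc hT hx)

theorem SpectralGap.compression (hV : ∀ x y, inner ℂ (V x) (V y) = inner ℂ x y) {c γ : ℝ} {n : ℕ}
    {t : Fin n → F} {u : F} (h : SpectralGap T c γ (fun i => V (t i)) (V u)) :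
    SpectralGap (compression V T) c γ t u where
  pos := h.pos
  norm_eq_one := by rw [← norm_map_eq hV, h.norm_eq_one]
  mem_eigSpace := mem_eigSpace_compression hV h.mem_eigSpace
  linearIndependent := LinearIndependent.of_comp (V : F →ₗ[ℂ] E) h.linearIndependent
  above i := by
    obtain ⟨μ, hμ, hi⟩ := h.above i
    exact ⟨μ, hμ, mem_eigSpace_compression hV hi⟩
  below w hw huw := by
    rw [inner_compression, ← norm_map_eq hV w]
    exact h.below (V w) (fun i => by rw [hV]; exact hw i) (by rw [hV]; exact huw)

end Compression

/-! ### The spectral gap at a simple eigenvalue -/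

section Leading

variable {E : Type} [NormedAddCommGroup E] [InnerProductSpace ℂ E]

theorem HasPosEigs.exists_pos {T : E →L[ℂ] E} {J : ℕ} (h : HasPosEigs T J) :
    ∃ x, 0 < x ∧ (J : Cardinal) ≤ eigCount T (Set.Ici x) :=
  exists_le_eigCount_Ici h

/-- The positivity hypothesis guarantees that the suprema defining the eigenvalues are over
nonempty sets. -/
theorem HasPosEigs.eigLargest_antitone {T : E →L[ℂ] E} {J : ℕ} (h : HasPosEigs T J)
    (hT : (T : E →ₗ[ℂ] E).IsSymmetric) {i j : ℕ} (hi : 1 ≤ i) (hij : i ≤ j) (hj : j ≤ J) :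
    eigLargest T j ≤ eigLargest T i := by
  obtain ⟨x, -, hx⟩ := h.exists_pos
  refine csSup_le_csSup (bddAbove_eigCount hT hi) ⟨x, ?_⟩ fun y hy => ?_
  · exact (Nat.cast_le.2 hj).trans hx
  · exact le_trans (Nat.cast_le.2 hij) (show (j : Cardinal) ≤ eigCount T (Set.Ici y) from hy)

theorem IsLeadingEigenvectors.mem_eigSpace {T : E →L[ℂ] E} {J : ℕ} {s : Fin J → E}
    (hs : IsLeadingEigenvectors T s) (i : Fin J) : s i ∈ eigSpace T (eigLargest T (i + 1)) :=
  (hs.2 i).1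

/-- If the eigenvalue number `n + 1` is simple, then the leading eigenvectors span the eigenspaces
for all eigenvalues at least as large, and the eigenvalue is isolated from both sides. -/
theorem IsLeadingEigenvectors.exists_spectralGap [CompleteSpace E] {T : E →L[ℂ] E} {n : ℕ}
    {s : Fin (n + 1) → E} (hs : IsLeadingEigenvectors T s) (hTc : IsCompactOperator T)
    (hT : (T : E →ₗ[ℂ] E).IsSymmetric) (hpos : HasPosEigs T (n + 1))
    (hsimple : IsSimpleEig T (eigLargest T (n + 1))) :
    ∃ γ, SpectralGap T (eigLargest T (n + 1)) γ (fun i : Fin n => s i.castSucc)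
      (((‖s (Fin.last n)‖⁻¹ : ℝ) : ℂ) • s (Fin.last n)) := by
  set c := eigLargest T (n + 1) with hc
  have hc0 : 0 < c := lt_eigLargest hT (by omega) hpos
  have hlast : s (Fin.last n) ∈ eigSpace T c := by simpa using hs.mem_eigSpace (Fin.last n)
  have hlast0 : s (Fin.last n) ≠ 0 := (hs.2 _).2
  have hnorm : 0 < ‖s (Fin.last n)‖ := norm_pos_iff.2 hlast0
  have hge : ∀ i : Fin (n + 1), c ≤ eigLargest T (i + 1) := fun i =>
    hpos.eigLargest_antitone hT (by omega) (by omega) le_rfl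
  have hgt : ∀ i : Fin n, c < eigLargest T (i + 1) := by
    intro i
    refine lt_of_le_of_ne (hge i.castSucc) fun heq => ?_
    have hi : s i.castSucc ∈ eigSpace T c := by
      rw [heq]; exact hs.mem_eigSpace i.castSucc
    obtain ⟨a, ha⟩ := (finrank_eq_one_iff_of_nonzero' (⟨_, hlast⟩ : eigSpace T c)
      (by simpa using hlast0)).1 hsimple ⟨_, hi⟩
    have ha' : a • s (Fin.last n) = s i.castSucc := congrArg Subtype.val ha
    have := hs.1.eq_of_smul_apply_eq_smul_apply 1 a i.castSucc (Fin.last n) one_ne_zero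
      (by rw [one_smul, ha'])
    exact absurd this (Fin.castSucc_lt_last i).ne
  obtain ⟨b, hcb, hb⟩ : ∃ b, c < b ∧ ∀ i : Fin n, b ≤ eigLargest T (i + 1) := by
    have h1 : ∀ᶠ b in nhdsWithin c (Set.Ioi c), ∀ i : Fin n, b ≤ eigLargest T (i + 1) :=
      Filter.eventually_all.2 fun i => nhdsWithin_le_nhds
        (Filter.mem_of_superset (Iio_mem_nhds (hgt i)) fun _ hy => (Set.mem_Iio.1 hy).le)
    obtain ⟨b, hb1, hb2⟩ := (h1.and self_mem_nhdsWithin).exists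
    exact ⟨b, hb2, hb1⟩
  obtain ⟨x, hxc, hx⟩ := exists_specSpace_gap hTc hT hc0
  -- by the definition of the eigenvalue number `n + 1` and by simplicity, the span of the
  -- eigenspaces for eigenvalues `≥ c` has dimension at most `n + 1`
  have hspan : Submodule.span ℂ (Set.range s) = specSpace T (Set.Ici c) := by
    have hfin := finiteDimensional_specSpace hTc hT hc0
    have hle : specSpace T (Set.Ioi c) ≤ specSpace T (Set.Ici c) :=
      specSpace_mono T Set.Ioi_subset_Ici_self
    have hfin' := Submodule.finiteDimensional_of_le hle
    have hfin'' := Submodule.finiteDimensional_of_le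
      (eigSpace_le_specSpace T (Set.self_mem_Ici (a := c)))
    refine Submodule.eq_of_le_of_finrank_le ?_ ?_
    · rw [Submodule.span_le]
      rintro _ ⟨i, rfl⟩
      exact eigSpace_le_specSpace T (Set.mem_Ici.2 (hge i)) (hs.mem_eigSpace i)
    · have h1 : Module.finrank ℂ (specSpace T (Set.Ioi c)) ≤ n := by
        by_contra! h
        have : ((n + 1 : ℕ) : Cardinal) ≤ eigCount T (Set.Ioi c) := by
          rw [eigCount_eq, ← Module.finrank_eq_rank]
          exact Nat.cast_le.2 h
        exact lt_irrefl _ (lt_eigLargest hT (by omega) this)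
      have h2 : specSpace T (Set.Ici c) ≤ specSpace T (Set.Ioi c) ⊔ eigSpace T c := by
        refine iSup₂_le fun μ hμ => ?_
        rcases eq_or_lt_of_le (Set.mem_Ici.1 hμ) with rfl | h
        · exact le_sup_right
        · exact (eigSpace_le_specSpace T (Set.mem_Ioi.2 h)).trans le_sup_left
      have h3 := Submodule.finrank_mono h2
      have h4 := Submodule.finrank_add_le_finrank_add_finrank (specSpace T (Set.Ioi c))
        (eigSpace T c)
      have h5 : Module.finrank ℂ (eigSpace T c) = 1 := hsimple
      rw [finrank_span_eq_card hs.1, Fintype.card_fin]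
      omega
  refine ⟨min (c - x) (b - c), ?_⟩
  have hγ1 := min_le_left (c - x) (b - c)
  have hγ2 := min_le_right (c - x) (b - c)
  refine ⟨lt_min (by linarith) (by linarith), ?_, Submodule.smul_mem _ _ hlast,
    hs.1.comp _ (Fin.castSucc_injective n), fun i => ⟨_, ?_, hs.mem_eigSpace i.castSucc⟩, ?_⟩
  · rw [norm_smul, Complex.norm_real, norm_inv, norm_norm, inv_mul_cancel₀ hnorm.ne']
  · have := hb i
    simp only [Fin.val_castSucc]
    linarith
  · intro w hw huw
    rcases eq_or_ne w 0 with rfl | hw0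
    · simp
    have hmem : w ∈ (specSpace T (Set.Ici x))ᗮ := by
      rw [hx, ← hspan]
      have hle : Submodule.span ℂ (Set.range s) ≤ (Submodule.span ℂ {w})ᗮ := by
        rw [Submodule.span_le]
        rintro _ ⟨i, rfl⟩
        refine Submodule.mem_orthogonal_singleton_iff_inner_left.2 ?_
        induction i using Fin.lastCases with
        | cast i => exact hw i
        | last =>
          rw [inner_smul_left, mul_eq_zero] at huw
          refine huw.resolve_left ?_
          simpa using hlast0
      exact (Submodule.mem_orthogonal _ _).2 fun y hy =>
        Submodule.mem_orthogonal_singleton_iff_inner_left.1 (hle hy)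
    refine (re_inner_lt_of_mem_orthogonal hTc hT hmem hw0).le.trans ?_
    exact mul_le_mul_of_nonneg_right (by linarith) (by positivity)

end Leading

/-! ### Differentiability and Hermite interpolation -/

section Interpolation

open Asymptotics Topology

variable {d : ℕ}

/-- A simple eigenvalue of a family of compact self-adjoint operators is differentiable, with the
derivative of the quadratic form of the family at the eigenvector. -/
theorem SpectralGap.hasFDerivAt_eigLargest {E : Type} [NormedAddCommGroup E]
    [InnerProductSpace ℂ E] [CompleteSpace E] {B : Param d → E →L[ℂ] E} {x : Param d} {c γ : ℝ}
    {n : ℕ} {t : Fin n → E} {u : E} (h : SpectralGap (B x) c γ t u)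
    (hBc : ∀ ω, IsCompactOperator (B ω)) (hB : ∀ ω, (B ω : E →ₗ[ℂ] E).IsSymmetric)
    (hO : (fun ω => B ω - B x) =O[𝓝 x] fun ω => ω - x) {g' : Param d →L[ℝ] ℝ}
    (hg : HasFDerivAt (fun ω => (inner ℂ ((B ω - B x) u) u).re) g' x) :
    HasFDerivAt (fun ω => eigLargest (B ω) (n + 1)) g' x := by
  set g : Param d → ℝ := fun ω => (inner ℂ ((B ω - B x) u) u).re with hgdef
  have hγ := h.pos
  have hlim : Filter.Tendsto (fun ω => ‖B ω - B x‖) (𝓝 x) (𝓝 0) := by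
    refine (hO.trans_tendsto ?_).norm.trans (by simp)
    have : Filter.Tendsto (fun ω : Param d => ω - x) (𝓝 x) (𝓝 (x - x)) :=
      (continuous_id.sub continuous_const).tendsto x
    simpa using this
  have hsmall : ∀ᶠ ω in 𝓝 x, ‖B ω - B x‖ ≤ γ / 4 :=
    hlim.eventually (Iic_mem_nhds (by positivity))
  have hr : (fun ω => eigLargest (B ω) (n + 1) - (c + g ω)) =O[𝓝 x] fun ω => ‖ω - x‖ ^ 2 := by
    have h1 : (fun ω => eigLargest (B ω) (n + 1) - (c + g ω)) =O[𝓝 x]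
        fun ω => ‖B ω - B x‖ ^ 2 := by
      refine IsBigO.of_bound (2 / γ) (hsmall.mono fun ω hω => ?_)
      rw [Real.norm_eq_abs, Real.norm_of_nonneg (by positivity)]
      exact h.abs_eigLargest_sub_le (hB x) (hBc ω) (hB ω) hω
    exact h1.trans (hO.norm_norm.pow 2)
  have h0 := hr.hasFDerivAt (𝕜 := ℝ) one_lt_two
  have := h0.add (hg.const_add c)
  rw [zero_add] at this
  refine this.congr_of_eventuallyEq (Filter.Eventually.of_forall fun ω => ?_)
  simp

/-- Hermite interpolation at a point whose leading eigenvectors belong to the subspace. The reduced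
operator inherits the eigenvectors, and with them the spectral gap; hence both eigenvalues have
the same first order perturbation term. -/
theorem hermiteInterpolatesAt {A : Param d → Ell2 →L[ℂ] Ell2}
    (hAc : ∀ ω, IsCompactOperator (A ω)) (hA : ∀ ω, (A ω : Ell2 →ₗ[ℂ] Ell2).IsSymmetric)
    {x : Param d} (hO : (fun ω => A ω - A x) =O[𝓝 x] fun ω => ω - x)
    (hg : ∀ u, DifferentiableAt ℝ (fun ω => (inner ℂ ((A ω - A x) u) u).re) x) {J : ℕ}
    (hJ : 1 ≤ J) (hpos : HasPosEigs (A x) J) {s : Fin J → Ell2}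
    (hs : IsLeadingEigenvectors (A x) s) {𝒱 : Submodule ℂ Ell2} (hs𝒱 : ∀ i, s i ∈ 𝒱) {m : ℕ}
    (v : OrthonormalBasis (Fin m) ℂ 𝒱) : HermiteInterpolatesAt A v J x := by
  obtain ⟨n, rfl⟩ : ∃ n, J = n + 1 := ⟨J - 1, by omega⟩
  have hV : ∀ y z, inner ℂ (basisMap v y) (basisMap v z) = inner ℂ y z := by
    intro y z
    exact v.repr.symm.inner_map_map y z
  set t : Fin (n + 1) → EuclideanSpace ℂ (Fin m) := fun i => v.repr ⟨s i, hs𝒱 i⟩ with ht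
  have hVt : ∀ i, basisMap v (t i) = s i := by
    intro i
    simp [basisMap, ht]
  have htind : LinearIndependent ℂ t := by
    refine LinearIndependent.of_comp (basisMap v : EuclideanSpace ℂ (Fin m) →ₗ[ℂ] Ell2) ?_
    have : (basisMap v : EuclideanSpace ℂ (Fin m) →ₗ[ℂ] Ell2) ∘ t = s := funext hVt
    rw [this]
    exact hs.1
  have hred : ∀ T, reducedOp v T = compression (basisMap v) T := fun _ => rfl
  have hvalue : lam A (n + 1) x = lamRed A v (n + 1) x := by
    refine (eigLargest_compression hV (hAc x) (hA x) hJ htind fun i => ?_).symm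
    refine ⟨_, hpos.eigLargest_antitone (hA x) (i := i + 1) (by omega) (by omega) le_rfl, ?_⟩
    rw [hVt]
    exact hs.mem_eigSpace i
  have hgap : IsSimpleEig (A x) (lam A (n + 1) x) → ∃ γ, ∃ u : EuclideanSpace ℂ (Fin m),
      SpectralGap (A x) (lam A (n + 1) x) γ (fun i : Fin n => basisMap v (t i.castSucc))
        (basisMap v u) := by
    intro hsimple
    obtain ⟨γ, hγ⟩ := hs.exists_spectralGap (hAc x) (hA x) hpos hsimple
    refine ⟨γ, ((‖s (Fin.last n)‖⁻¹ : ℝ) : ℂ) • t (Fin.last n), ?_⟩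
    rw [map_smul]
    simpa only [hVt, lam] using hγ
  refine ⟨hvalue, fun hn => ?_, fun hsimple => ?_, fun hsimple => ?_⟩
  · refine (eigLargest_compression hV (hAc x) (hA x) (j := n) (by omega)
      (htind.comp _ (Fin.castSucc_injective n)) fun i => ?_).symm
    refine ⟨_, hpos.eigLargest_antitone (hA x) (i := i + 1) (by omega) (by omega) (by omega), ?_⟩
    rw [Function.comp_apply, hVt]
    exact hs.mem_eigSpace i.castSucc
  · obtain ⟨γ, u, h⟩ := hgap hsimple
    rw [← hvalue, hred]
    exact (h.compression hV).isSimpleEig (isSymmetric_compression (hA x))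
  · obtain ⟨γ, u, h⟩ := hgap hsimple
    have hg' := (hg (basisMap v u)).hasFDerivAt
    have h1 : HasFDerivAt (lam A (n + 1)) _ x := h.hasFDerivAt_eigLargest hAc hA hO hg'
    have hOred : (fun ω => compression (basisMap v) (A ω) - compression (basisMap v) (A x))
        =O[𝓝 x] fun ω => ω - x := by
      refine IsBigO.trans (IsBigO.of_bound 1 (Filter.Eventually.of_forall fun ω => ?_)) hO
      rw [compression_sub, one_mul]
      exact norm_compression_le hV
    have h2 : HasFDerivAt (lamRed A v (n + 1)) _ x :=
      (h.compression hV).hasFDerivAt_eigLargest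
        (B := fun ω => compression (basisMap v) (A ω))
        (fun ω => isCompactOperator_compression (hAc ω))
        (fun ω => isSymmetric_compression (hA ω)) hOred
        (by simpa only [compression_sub, inner_compression] using hg')
    refine ⟨h1.differentiableAt, h2.differentiableAt, ?_⟩
    rw [gradient, gradient, h1.fderiv, h2.fderiv]

end Interpolation

/-! ### The operator family -/

section Family

open Asymptotics Topology

variable {d κ : ℕ} {f : Fin κ → Param d → ℝ} {A : Fin κ → Ell2 →L[ℂ] Ell2}

theorem isCompactOperator_opFun (hA : ∀ i, IsCompactOperator (A i)) (ω : Param d) :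
    IsCompactOperator (opFun f A ω) :=
  Submodule.sum_mem (compactOperator (RingHom.id ℂ) Ell2 Ell2) fun i _ =>
    Submodule.smul_mem _ _ (hA i)

theorem isSymmetric_opFun (hA : ∀ i, IsSelfAdjoint (A i)) (ω : Param d) :
    (opFun f A ω : Ell2 →ₗ[ℂ] Ell2).IsSymmetric := by
  have : IsSelfAdjoint (opFun f A ω) :=
    isSelfAdjoint_sum _ fun i _ => IsSelfAdjoint.smul (Complex.conj_ofReal _) (hA i)
  exact this.isSymmetric

theorem opFun_sub (ω x : Param d) :
    opFun f A ω - opFun f A x = ∑ i, ((f i ω - f i x : ℝ) : ℂ) • A i := by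
  simp only [opFun, ← Finset.sum_sub_distrib, ← sub_smul, Complex.ofReal_sub]

theorem isBigO_opFun_sub {x : Param d} (hf : ∀ i, DifferentiableAt ℝ (f i) x) :
    (fun ω => opFun f A ω - opFun f A x) =O[𝓝 x] fun ω => ω - x := by
  simp only [opFun_sub]
  refine IsBigO.fun_sum fun i _ => ?_
  have h : (fun ω => ((f i ω - f i x : ℝ) : ℂ) • A i) =O[𝓝 x] fun ω => f i ω - f i x := by
    refine IsBigO.of_bound ‖A i‖ (Filter.Eventually.of_forall fun ω => ?_)
    rw [norm_smul, Complex.norm_real, mul_comm]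
  exact h.trans (hf i).isBigO_sub

theorem differentiableAt_re_inner_opFun_sub {x : Param d} (hf : ∀ i, DifferentiableAt ℝ (f i) x)
    (u : Ell2) :
    DifferentiableAt ℝ (fun ω => (inner ℂ ((opFun f A ω - opFun f A x) u) u).re) x := by
  have h : ∀ ω, (inner ℂ ((opFun f A ω - opFun f A x) u) u).re =
      ∑ i, (f i ω - f i x) * (inner ℂ (A i u) u).re := by
    intro ω
    rw [opFun_sub, sum_apply, sum_inner, Complex.re_sum]
    refine Finset.sum_congr rfl fun i _ => ?_
    rw [smul_apply, inner_smul_left, Complex.conj_ofReal,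
      Complex.re_ofReal_mul]
  simp only [h]
  exact DifferentiableAt.fun_sum fun i _ => ((hf i).sub_const _).mul_const _

end Family

/-! ### The subspaces of the greedy procedures -/

section Runs

variable {d : ℕ} {goal : Goal} {A : Param d → Ell2 →L[ℂ] Ell2} {Ω : Set (Param d)} {J K : ℕ}

theorem Goal.IsOptimizer.mem {g : Param d → ℝ} {x : Param d} (h : goal.IsOptimizer g Ω x) :
    x ∈ Ω := by
  cases goal <;> exact h.1

theorem mem_of_start_of_succ {ω : ℕ → Param d} (h1 : ω 1 ∈ Ω)
    (hsucc : ∀ k, 1 ≤ k → k + 1 ≤ K → ω (k + 1) ∈ Ω) {l : ℕ} (hl : 1 ≤ l) (hlK : l ≤ K) :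
    ω l ∈ Ω := by
  obtain rfl | hl := hl.eq_or_lt
  · exact h1
  · obtain ⟨k, rfl⟩ : ∃ k, l = k + 1 := ⟨l - 1, by omega⟩
    exact hsucc k (by omega) hlK

theorem subspace_mono {S : ℕ → Submodule ℂ Ell2}
    (hsucc : ∀ k, 1 ≤ k → k + 1 ≤ K → S k ≤ S (k + 1)) {k l : ℕ} (hl : 1 ≤ l) (hlk : l ≤ k)
    (hk : k ≤ K) : S l ≤ S k := by
  induction k, hlk using Nat.le_induction with
  | base => exact le_rfl
  | succ k hlk ih => exact (ih (by omega)).trans (hsucc k (by omega) hk)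

theorem GreedyRun.s_mem (R : GreedyRun goal A Ω J K) {k l : ℕ} (hl : 1 ≤ l) (hlk : l ≤ k)
    (hk : k ≤ K) (i : Fin J) : R.s l i ∈ R.S k := by
  refine subspace_mono (fun k hk hkK => R.space_succ k hk hkK ▸ le_sup_left) hl hlk hk ?_
  obtain rfl | hl := hl.eq_or_lt
  · rw [R.space_one]
    exact Submodule.subset_span ⟨i, rfl⟩
  · obtain ⟨l, rfl⟩ : ∃ k, l = k + 1 := ⟨l - 1, by omega⟩
    rw [R.space_succ l (by omega) (by omega)]
    exact Submodule.mem_sup_right (Submodule.subset_span ⟨i, rfl⟩)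

theorem ExtendedGreedyRun.S_mono (R : ExtendedGreedyRun goal A Ω J K) {k l : ℕ} (hl : 1 ≤ l)
    (hlk : l ≤ k) (hk : k ≤ K) : R.S l ≤ R.S k := by
  refine subspace_mono (fun k hk hkK => ?_) hl hlk hk
  rw [R.space_succ k hk hkK]
  exact le_sup_left.trans le_sup_left

theorem ExtendedGreedyRun.s_mem (R : ExtendedGreedyRun goal A Ω J K) {k l : ℕ} (hl : 1 ≤ l)
    (hlk : l ≤ k) (hk : k ≤ K) (i : Fin J) : R.s l i ∈ R.S k := by
  refine R.S_mono hl hlk hk ?_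
  obtain rfl | hl := hl.eq_or_lt
  · rw [R.space_one]
    exact Submodule.subset_span ⟨i, rfl⟩
  · obtain ⟨l, rfl⟩ : ∃ k, l = k + 1 := ⟨l - 1, by omega⟩
    rw [R.space_succ l (by omega) (by omega)]
    exact Submodule.mem_sup_left (Submodule.mem_sup_right (Submodule.subset_span ⟨i, rfl⟩))

theorem ExtendedGreedyRun.t_mem (R : ExtendedGreedyRun goal A Ω J K) {k l : ℕ} (hl : 2 ≤ l)
    (hlk : l ≤ k) (hk : k ≤ K) {p q : Fin d} (hpq : p ≤ q) (i : Fin J) :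
    R.t l p q i ∈ R.S k := by
  refine R.S_mono (by omega) hlk hk ?_
  obtain ⟨l, rfl⟩ : ∃ k, l = k + 1 := ⟨l - 1, by omega⟩
  rw [R.space_succ l (by omega) (by omega)]
  refine Submodule.mem_sup_right ?_
  refine Submodule.mem_iSup_of_mem p (Submodule.mem_iSup_of_mem q
    (Submodule.mem_iSup_of_mem hpq (Submodule.subset_span ⟨i, rfl⟩)))

end Runs

end EigOpt

end

theorem lemma2p6 {d κ : ℕ} (J : ℕ) (hJ : 1 ≤ J)
    (Ωbar Ω : Set (EigOpt.Param d)) (hopen : IsOpen Ωbar) (hcompact : IsCompact Ω)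
    (hsub : Ω ⊆ Ωbar)
    (f : Fin κ → EigOpt.Param d → ℝ) (hf : ∀ i, AnalyticOnNhd ℝ (f i) Ωbar)
    (A : Fin κ → EigOpt.Ell2 →L[ℂ] EigOpt.Ell2)
    (hAc : ∀ i, IsCompactOperator (A i)) (hAs : ∀ i, IsSelfAdjoint (A i))
    (hpos : ∀ ω ∈ Ω, EigOpt.HasPosEigs (EigOpt.opFun f A ω) J)
    (goal : EigOpt.Goal) (K : ℕ) :
    -- the greedy subspace procedure
    (∀ R : EigOpt.GreedyRun goal (EigOpt.opFun f A) Ω J K,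
      ∀ k l : ℕ, 1 ≤ l → l ≤ k → k ≤ K →
        EigOpt.HermiteInterpolatesAt (EigOpt.opFun f A) (R.basis k) J (R.ω l)) ∧
    -- the extended greedy subspace procedure
    (∀ R : EigOpt.ExtendedGreedyRun goal (EigOpt.opFun f A) Ω J K,
      -- the operator function and its `J` largest eigenvalues are defined at the extra points
      (∀ l : ℕ, 2 ≤ l → l ≤ K → ∀ p q : Fin d, p ≤ q →
        R.extraPoint l p q ∈ Ωbar ∧
          EigOpt.HasPosEigs (EigOpt.opFun f A (R.extraPoint l p q)) J) →
      (∀ k l : ℕ, 1 ≤ l → l ≤ k → k ≤ K →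
        EigOpt.HermiteInterpolatesAt (EigOpt.opFun f A) (R.basis k) J (R.ω l)) ∧
      (∀ k l : ℕ, 2 ≤ l → l ≤ k → k ≤ K → ∀ p q : Fin d, p ≤ q →
        EigOpt.HermiteInterpolatesAt (EigOpt.opFun f A) (R.basis k) J
          (R.extraPoint l p q))) := by
  have main : ∀ x ∈ Ωbar, EigOpt.HasPosEigs (EigOpt.opFun f A x) J → ∀ s : Fin J → EigOpt.Ell2,
      EigOpt.IsLeadingEigenvectors (EigOpt.opFun f A x) s →
      ∀ (𝒱 : Submodule ℂ EigOpt.Ell2), (∀ i, s i ∈ 𝒱) →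
      ∀ (m : ℕ) (v : OrthonormalBasis (Fin m) ℂ 𝒱),
        EigOpt.HermiteInterpolatesAt (EigOpt.opFun f A) v J x := by
    intro x hx hxpos s hs 𝒱 hs𝒱 m v
    have hdiff : ∀ i, DifferentiableAt ℝ (f i) x := fun i => (hf i x hx).differentiableAt
    exact EigOpt.hermiteInterpolatesAt (EigOpt.isCompactOperator_opFun hAc)
      (EigOpt.isSymmetric_opFun hAs) (EigOpt.isBigO_opFun_sub hdiff)
      (EigOpt.differentiableAt_re_inner_opFun_sub hdiff) hJ hxpos hs hs𝒱 v
  refine ⟨fun R k l hl hlk hk => ?_, fun R hextra => ⟨fun k l hl hlk hk => ?_,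
    fun k l hl hlk hk p q hpq => ?_⟩⟩
  · have hmem : R.ω l ∈ Ω := EigOpt.mem_of_start_of_succ R.start_mem
      (fun k hk hkK => (R.optimal k hk hkK).mem) hl (hlk.trans hk)
    exact main _ (hsub hmem) (hpos _ hmem) _ (R.eigvec l hl (hlk.trans hk)) _
      (R.s_mem hl hlk hk) _ _
  · have hmem : R.ω l ∈ Ω := EigOpt.mem_of_start_of_succ R.start_mem
      (fun k hk hkK => (R.optimal k hk hkK).mem) hl (hlk.trans hk)
    exact main _ (hsub hmem) (hpos _ hmem) _ (R.eigvec l hl (hlk.trans hk)) _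
      (R.s_mem hl hlk hk) _ _
  · obtain ⟨hx, hxpos⟩ := hextra l hl (hlk.trans hk) p q hpq
    have hs : EigOpt.IsLeadingEigenvectors (EigOpt.opFun f A (R.extraPoint l p q))
        (R.t l p q) := by
      obtain ⟨l, rfl⟩ : ∃ k, l = k + 1 := ⟨l - 1, by omega⟩
      exact R.eigvec_extra l (by omega) (hlk.trans hk) p q hpq
    exact main _ hx hxpos _ hs _ (R.t_mem hl hlk hk hpq) _ _
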